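/- Let $\mathfrak A$ be a (not necessarily unital) $C^*$-algebra, let $H$ be a Hilbert $\mathfrak A$-module, and let $\mathcal L(H)$ be the $C^*$-algebra of adjointable operators on $H$, with $\mathcal R(T)$ the range of $T$ and $|T|=(T^*T)^{1/2}$. For $T,U\in\mathcal L(H)$ we say that "$T=U|T|$ is the polar decomposition" if $U$ is a partial isometry (that is, $U^*U$ is a projection), $T=U|T|$, the closed submodule $\overline{\mathcal R(T^*)}$ is orthogonally complemented in $H$, and $U^*U$ is the projection of $H$ onto $\overline{\mathcal R(T^*)}$. Suppose that $T=U_T|T|$, $A=U_A|A|$ and $S=U_S|S|$ are the polar decompositions of $T,A,S\in\mathcal L(H)$, respectively. Put $$X=TAS,\qquad Y=|T|\,A\,|S^*|,\qquad W=U_T^*U_TU_AU_SU_S^*.$$ Then the following statements are equivalent: (i) $X=U_TU_AU_S|X|$; (ii) $Y=W|Y|$; (iii) $U_A^*Y\ge 0$ and $U_AU_A^*Y=Y$. If one of (i), (ii) and (iii) is satisfied, and either $\overline{\mathcal R(W)}=\overline{\mathcal R(Y)}$ or $\overline{\mathcal R(W^*)}=\overline{\mathcal R(Y^*)}$, then $X=U_TU_AU_S|X|$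 and $Y=W|Y|$ are the polar decompositions. Conversely, if $Y=W|Y|$ is the polar decomposition, then both $\overline{\mathcal R(W)}=\overline{\mathcal R(Y)}$ and $\overline{\mathcal R(W^*)}=\overline{\mathcal R(Y^*)}$ hold. -/

import Mathlib

noncomputable section

/-! ## Adjointable operators on a Hilbert `C⋆`-module

`𝔄` is a (not necessarily unital) `C⋆`-algebra, and a Hilbert `𝔄`-module is a `CStarModule 𝔄 H` that
is complete for the norm `‖x‖ = √‖⟪x, x⟫‖`. -/

namespace HilbertModule

section Operators

variable {𝔄 H : Type*} [NonUnitalCStarAlgebra 𝔄] [PartialOrder 𝔄] [StarOrderedRing 𝔄]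
  [NormedAddCommGroup H] [NormedSpace ℂ H] [SMul 𝔄 H] [CStarModule 𝔄 H]

variable (𝔄) in
theorem ext_inner {u v : H} (h : ∀ x : H, inner 𝔄 x u = inner 𝔄 x v) : u = v := by
  have h0 : inner 𝔄 (u - v) (u - v) = 0 := by
    rw [CStarModule.inner_sub_right, h (u - v), sub_self]
  exact sub_eq_zero.mp (CStarModule.inner_self.mp h0)

theorem norm_adjoint_apply_le (T : H →L[ℂ] H) (S : H → H)
    (h : ∀ x y : H, inner 𝔄 (T x) y = inner 𝔄 x (S y)) (y : H) : ‖S y‖ ≤ ‖T‖ * ‖y‖ := by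
  by_cases h0 : ‖S y‖ = 0
  · rw [h0]; positivity
  have hpos : 0 < ‖S y‖ := lt_of_le_of_ne (norm_nonneg _) (Ne.symm h0)
  have h1 : ‖S y‖ ^ 2 ≤ ‖T (S y)‖ * ‖y‖ := by
    rw [CStarModule.norm_sq_eq 𝔄, ← h]
    exact CStarModule.norm_inner_le H
  have h2 : ‖T (S y)‖ * ‖y‖ ≤ ‖T‖ * ‖S y‖ * ‖y‖ := by
    gcongr
    exact T.le_opNorm _
  nlinarith

/-- A map that is adjoint to a bounded operator is itself a bounded linear operator. -/
theorem exists_clm_adjoint (T : H →L[ℂ] H) (S : H → H)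
    (h : ∀ x y : H, inner 𝔄 (T x) y = inner 𝔄 x (S y)) :
    ∃ S' : H →L[ℂ] H, ∀ y, S' y = S y := by
  let L : H →ₗ[ℂ] H :=
    { toFun := S
      map_add' := fun u v => ext_inner 𝔄 fun x => by
        rw [← h, CStarModule.inner_add_right, CStarModule.inner_add_right, h, h]
      map_smul' := fun z u => ext_inner 𝔄 fun x => by
        rw [← h, RingHom.id_apply, CStarModule.inner_smul_right_complex,
          CStarModule.inner_smul_right_complex, h] }
  exact ⟨L.mkContinuous ‖T‖ (norm_adjoint_apply_le T S h), fun y => rfl⟩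

variable (𝔄 H) in
/-- The algebra `𝓛(H)` of adjointable operators: those operators `T : H → H` for which there is a
map `T⋆ : H → H` with `⟪T x, y⟫ = ⟪x, T⋆ y⟫` for all `x, y`. It carries the operator norm. -/
def adjointable : Subalgebra ℂ (H →L[ℂ] H) where
  carrier := {T | ∃ S : H → H, ∀ x y : H, inner 𝔄 (T x) y = inner 𝔄 x (S y)}
  mul_mem' := by
    rintro T T' ⟨S, hS⟩ ⟨S', hS'⟩
    exact ⟨fun y => S' (S y), fun x y => by
      rw [mul_apply_eq_comp, hS, hS']⟩
  add_mem' := by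
    rintro T T' ⟨S, hS⟩ ⟨S', hS'⟩
    exact ⟨fun y => S y + S' y, fun x y => by
      rw [add_apply, CStarModule.inner_add_left,
        CStarModule.inner_add_right, hS, hS']⟩
  algebraMap_mem' := fun z => ⟨fun y => star z • y, fun x y => by
    rw [Algebra.algebraMap_eq_smul_one, smul_apply,
      one_apply_eq_self, CStarModule.inner_smul_left_complex,
      CStarModule.inner_smul_right_complex]⟩

/-- The adjoint `T⋆` of `T ∈ 𝓛(H)`. -/
def adjoint (T : adjointable 𝔄 H) : adjointable 𝔄 H :=
  ⟨(exists_clm_adjoint T.1 T.2.choose T.2.choose_spec).choose, T.1, fun x y => by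
    rw [(exists_clm_adjoint T.1 T.2.choose T.2.choose_spec).choose_spec,
      ← CStarModule.star_inner, ← T.2.choose_spec, CStarModule.star_inner]⟩

theorem inner_adjoint_right (T : adjointable 𝔄 H) (x y : H) :
    inner 𝔄 (T.1 x) y = inner 𝔄 x ((adjoint T).1 y) := by
  rw [T.2.choose_spec x y]
  congr 1
  exact ((exists_clm_adjoint T.1 T.2.choose T.2.choose_spec).choose_spec y).symm

theorem inner_adjoint_left (T : adjointable 𝔄 H) (x y : H) :
    inner 𝔄 ((adjoint T).1 x) y = inner 𝔄 x (T.1 y) := by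
  rw [← CStarModule.star_inner, ← inner_adjoint_right, CStarModule.star_inner]

theorem eq_adjoint {T S : adjointable 𝔄 H}
    (h : ∀ x y : H, inner 𝔄 (T.1 x) y = inner 𝔄 x (S.1 y)) : adjoint T = S := by
  refine Subtype.ext (ContinuousLinearMap.ext fun y => ext_inner 𝔄 fun x => ?_)
  rw [← h, inner_adjoint_right]

theorem isClosed_adjointable [CompleteSpace H] :
    IsClosed (adjointable 𝔄 H : Set (H →L[ℂ] H)) := by
  refine isClosed_of_closure_subset fun T hT => ?_
  obtain ⟨u, hu, hlim⟩ := mem_closure_iff_seq_limit.mp hT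
  let v : ℕ → adjointable 𝔄 H := fun n => ⟨u n, hu n⟩
  have hle : ∀ m n, dist (adjoint (v m)).1 (adjoint (v n)).1 ≤ dist (u m) (u n) := by
    intro m n
    rw [dist_eq_norm, dist_eq_norm]
    refine ContinuousLinearMap.opNorm_le_bound _ (norm_nonneg _) fun y => ?_
    refine norm_adjoint_apply_le (𝔄 := 𝔄) (u m - u n) (⇑((adjoint (v m)).1 - (adjoint (v n)).1))
      (fun x y => ?_) y
    have h1 := inner_adjoint_right (v m) x y
    have h2 := inner_adjoint_right (v n) x y
    rw [sub_apply, sub_apply,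
      CStarModule.inner_sub_left, CStarModule.inner_sub_right, ← h1, ← h2]
  have hc : CauchySeq fun n => (adjoint (v n)).1 := by
    rw [Metric.cauchySeq_iff]
    intro ε hε
    obtain ⟨N, hN⟩ := Metric.cauchySeq_iff.mp hlim.cauchySeq ε hε
    exact ⟨N, fun m hm n hn => (hle m n).trans_lt (hN m hm n hn)⟩
  obtain ⟨S, hS⟩ := cauchySeq_tendsto_of_complete hc
  refine ⟨S, fun x y => ?_⟩
  have hev : ∀ z : H, Continuous fun R : H →L[ℂ] H => R z := fun z => by fun_prop
  have hT' := ((hev x).tendsto T).comp hlim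
  have hS' := ((hev y).tendsto S).comp hS
  have e1 := (CStarModule.continuous_inner (A := 𝔄) (E := H)).tendsto (T x, y) |>.comp
    (hT'.prodMk_nhds (tendsto_const_nhds (x := y)))
  have e2 := (CStarModule.continuous_inner (A := 𝔄) (E := H)).tendsto (x, S y) |>.comp
    ((tendsto_const_nhds (x := x)).prodMk_nhds hS')
  refine tendsto_nhds_unique e1 (e2.congr fun n => ?_)
  exact (inner_adjoint_right (v n) x y).symm

instance : Star (adjointable 𝔄 H) := ⟨adjoint⟩

/-- The defining property of the adjoint. -/
theorem inner_star_right (T : adjointable 𝔄 H) (x y : H) :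
    inner 𝔄 (T.1 x) y = inner 𝔄 x ((star T).1 y) := inner_adjoint_right T x y

instance : StarRing (adjointable 𝔄 H) where
  star_involutive T := eq_adjoint (inner_adjoint_left T)
  star_mul T T' := eq_adjoint fun x y => by
    change inner 𝔄 (T.1 (T'.1 x)) y = inner 𝔄 x ((adjoint T').1 ((adjoint T).1 y))
    rw [inner_adjoint_right, inner_adjoint_right]
  star_add T T' := eq_adjoint fun x y => by
    change inner 𝔄 (T.1 x + T'.1 x) y = inner 𝔄 x ((adjoint T).1 y + (adjoint T').1 y)
    rw [CStarModule.inner_add_left, CStarModule.inner_add_right, inner_adjoint_right,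
      inner_adjoint_right]

instance : StarModule ℂ (adjointable 𝔄 H) where
  star_smul z T := eq_adjoint fun x y => by
    change inner 𝔄 (z • T.1 x) y = inner 𝔄 x (star z • (adjoint T).1 y)
    rw [CStarModule.inner_smul_left_complex, CStarModule.inner_smul_right_complex,
      inner_adjoint_right]

instance : CStarRing (adjointable 𝔄 H) where
  norm_mul_self_le T := by
    change ‖T.1‖ * ‖T.1‖ ≤ ‖(star T * T).1‖
    have key : ‖T.1‖ ≤ √‖(star T * T).1‖ := by
      refine ContinuousLinearMap.opNorm_le_bound _ (Real.sqrt_nonneg _) fun x => ?_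
      refine le_of_sq_le_sq ?_ (by positivity)
      rw [mul_pow, Real.sq_sqrt (norm_nonneg _), CStarModule.norm_sq_eq 𝔄, inner_star_right]
      calc ‖inner 𝔄 x ((star T).1 (T.1 x))‖ ≤ ‖x‖ * ‖(star T * T).1 x‖ :=
            CStarModule.norm_inner_le H
        _ ≤ ‖x‖ * (‖(star T * T).1‖ * ‖x‖) := by
            gcongr
            exact ContinuousLinearMap.le_opNorm _ _
        _ = ‖(star T * T).1‖ * ‖x‖ ^ 2 := by ring
    calc ‖T.1‖ * ‖T.1‖ ≤ √‖(star T * T).1‖ * √‖(star T * T).1‖ := by gcongr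
      _ = ‖(star T * T).1‖ := Real.mul_self_sqrt (norm_nonneg _)

instance [CompleteSpace H] : CompleteSpace (adjointable 𝔄 H) :=
  (isClosed_adjointable (𝔄 := 𝔄) (H := H)).completeSpace_coe

/-- `𝓛(H)` is a `C⋆`-algebra. -/
instance [CompleteSpace H] : CStarAlgebra (adjointable 𝔄 H) where

/-- `𝓛(H)` is ordered by the usual order of a `C⋆`-algebra: `0 ≤ T` means that `T` is
self-adjoint with non-negative spectrum. -/
instance [CompleteSpace H] : PartialOrder (adjointable 𝔄 H) := CStarAlgebra.spectralOrder _

instance [CompleteSpace H] : StarOrderedRing (adjointable 𝔄 H) :=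
  CStarAlgebra.spectralOrderedRing _

/-! ## Ranges, projections and polar decompositions -/

/-- The norm closure of the range of `T`. -/
def rangeClosure (T : adjointable 𝔄 H) : Submodule ℂ H :=
  (LinearMap.range (T.1 : H →ₗ[ℂ] H)).topologicalClosure

variable (𝔄) in
/-- The orthogonal complement `Mᗮ = {x | ⟪x, y⟫ = 0 for every y ∈ M}`. -/
def orthogonalComplement (M : Submodule ℂ H) : Submodule ℂ H where
  carrier := {x | ∀ y ∈ M, inner 𝔄 x y = 0}
  zero_mem' := fun y _ => CStarModule.inner_zero_left
  add_mem' := fun {u v} hu hv y hy => by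
    rw [CStarModule.inner_add_left, hu y hy, hv y hy, add_zero]
  smul_mem' := fun z u hu y hy => by
    rw [CStarModule.inner_smul_left_complex, hu y hy, smul_zero]

/-- `M` is orthogonally complemented in `H`, that is `H = M ∔ Mᗮ`, and `P` is the projection of `H`
onto `M` along `Mᗮ`. -/
structure IsProjectionOnto (P : adjointable 𝔄 H) (M : Submodule ℂ H) : Prop where
  isCompl : IsCompl M (orthogonalComplement 𝔄 M)
  apply_of_mem : ∀ x ∈ M, P.1 x = x
  apply_of_mem_orthogonal : ∀ x ∈ orthogonalComplement 𝔄 M, P.1 x = 0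

/-- `T = U|T|` is the polar decomposition of `T`, where `|T| = (T⋆T)^{1/2}`. -/
structure IsPolarDecomposition [CompleteSpace H] (T U : adjointable 𝔄 H) : Prop where
  /-- `U` is a partial isometry -/
  partialIsometry : IsStarProjection (star U * U)
  eq_mul_abs : T = U * CFC.abs T
  isProjectionOnto : IsProjectionOnto (star U * U) (rangeClosure (star T))

end Operators

end HilbertModule

end

/-! Put `p = U_T⋆U_T` and `q = U_SU_S⋆`. Since `T = U_T|T|` and `S = |S⋆|U_S`, one has `pY = Y = Yq`
and `X = U_T Y U_S`. Hence `|X| = U_S⋆|Y|U_S`, and (i) ⇔ (ii) is algebra.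

As `q|Y| = |Y|`, (ii) reads `Y = pU_A|Y|`. The crux is `eq_mul_cfcAbs_of_compression`: because `Y⋆Y
= |Y|²`, neither `U_A` nor `p` can shrink anything, so `Y = U_A|Y|` and `U_A⋆Y = |Y|`, which gives
(iii). Conversely, (iii) makes `U_A⋆Y` the positive root of `Y⋆Y`.

For polar decompositions, `of_rangeClosure_eq` reduces everything to two identities and one equality
of closed ranges. It applies to `Y` directly; the equality for `W⋆` and `Y⋆` is then carried over to
`X` by `rangeClosure_star_mul_mul_le`. -/

namespace PartialIsometry

/-! ### Partial isometries in a C⋆-algebra. -/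

variable {A : Type*} [CStarAlgebra A]

theorem mul_star_mul_self {u : A} (hu : IsStarProjection (star u * u)) : u * star u * u = u := by
  have hp : star u * u * (star u * u) = star u * u := hu.isIdempotentElem
  rw [← sub_eq_zero, ← CStarRing.star_mul_self_eq_zero_iff]
  calc star (u * star u * u - u) * (u * star u * u - u)
      = star u * u * (star u * u) * (star u * u) - star u * u * (star u * u)
        - (star u * u * (star u * u) - star u * u) := by
        simp only [star_sub, star_mul, star_star]; noncomm_ring
    _ = 0 := by simp only [hp, sub_self]

theorem star_mul_self_mul_star {u : A} (hu : IsStarProjection (star u * u)) :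
    star u * u * star u = star u := by
  simpa [mul_assoc] using congrArg star (mul_star_mul_self hu)

theorem isStarProjection_of_mul_star_mul_self {u : A} (hu : u * star u * u = u) :
    IsStarProjection (star u * u) where
  isIdempotentElem := by
    change star u * u * (star u * u) = star u * u
    rw [mul_assoc, ← mul_assoc u, hu]
  isSelfAdjoint := .star_mul_self u

end PartialIsometry

/-! ### Absolute values in a C⋆-algebra. -/

section AbsoluteValue

variable {A : Type*} [CStarAlgebra A]

theorem mul_eq_zero_of_mul_star_mul_self_mul {a b : A} (h : star b * (star a * a) * b = 0) :
    a * b = 0 := by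
  rw [← CStarRing.star_mul_self_eq_zero_iff]
  simpa [mul_assoc] using h

variable [PartialOrder A] [StarOrderedRing A]

theorem star_cfcAbs (a : A) : star (CFC.abs a) = CFC.abs a :=
  (IsSelfAdjoint.of_nonneg (CFC.abs_nonneg a)).star_eq

theorem cfcAbs_eq_of_mul_self_eq {a b : A} (hb : 0 ≤ b) (h : b * b = star a * a) :
    CFC.abs a = b :=
  CFC.sqrt_unique h hb

theorem mul_cfcAbs_eq {a p : A} (hp : star p = p) (h : p * star a = star a) :
    p * CFC.abs a = CFC.abs a := by
  have h1 : CFC.abs a * (1 - p) = 0 := by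
    refine mul_eq_zero_of_mul_star_mul_self_mul ?_
    rw [star_cfcAbs, CFC.abs_mul_abs, star_sub, star_one, hp, ← mul_assoc (1 - p), sub_mul 1, h,
      one_mul, sub_self, zero_mul, zero_mul]
  have h2 := congrArg star h1
  rw [star_mul, star_sub, star_one, hp, star_cfcAbs, star_zero, sub_mul, one_mul, sub_eq_zero] at h2
  exact h2.symm

/-- Serves to place the range of `|T|` in the closure of the range of `T⋆`, without any polar
decomposition of `T`. -/
theorem exists_norm_cfcAbs_sub_lt (a : A) {ε : ℝ} (hε : 0 < ε) :
    ∃ c : A, ‖CFC.abs a - star a * a * c‖ ≤ ε := by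
  set b := CFC.abs a with hb
  have hb0 : 0 ≤ b := CFC.abs_nonneg a
  have hpos : ∀ t ∈ spectrum ℝ b, 0 < t + ε := fun t ht => by
    linarith [spectrum_nonneg_of_nonneg hb0 ht]
  have hc : ContinuousOn (fun t : ℝ => (t + ε)⁻¹) (spectrum ℝ b) :=
    (continuous_id.add continuous_const).continuousOn.inv₀ fun t ht => (hpos t ht).ne'
  -- The witness is `(|a| + ε)⁻¹`; the error is `t - t²/(t + ε) = εt/(t + ε) ≤ ε` on the spectrum.
  refine ⟨cfc (fun t : ℝ => (t + ε)⁻¹) b, ?_⟩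
  have key : b - star a * a * cfc (fun t : ℝ => (t + ε)⁻¹) b
      = cfc (fun t : ℝ => t - t * t * (t + ε)⁻¹) b := by
    have hm : Continuous fun t : ℝ => t * t := continuous_id.mul continuous_id
    rw [cfc_sub (fun t : ℝ => t) (fun t => t * t * (t + ε)⁻¹) b continuousOn_id
        (hm.continuousOn.mul hc),
      cfc_mul (fun t : ℝ => t * t) (fun t => (t + ε)⁻¹) b hm.continuousOn hc,
      cfc_mul (fun t : ℝ => t) (fun t => t) b, cfc_id' ℝ b, hb, CFC.abs_mul_abs]
  rw [key]
  refine norm_cfc_le hε.le fun t ht => ?_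
  have h0 := spectrum_nonneg_of_nonneg hb0 ht
  have h1 := hpos t ht
  have h2 : t - t * t * (t + ε)⁻¹ = ε * (t / (t + ε)) := by field_simp; ring
  rw [h2, Real.norm_of_nonneg (by positivity)]
  exact mul_le_of_le_one_right hε.le ((div_le_one h1).2 (by linarith))

/-- If `y = p u |y|` for a projection `p` and a partial isometry `u`, then `y = u |y|` and
`u⋆ y = |y|`. -/
theorem eq_mul_cfcAbs_of_compression {y u p : A} (hu : IsStarProjection (star u * u))
    (hp : IsStarProjection p) (hy : y = p * u * CFC.abs y) :
    y = u * CFC.abs y ∧ star u * y = CFC.abs y := by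
  have hsp : star p = p := hp.isSelfAdjoint.star_eq
  have hpp : p * p = p := hp.isIdempotentElem
  have hq := hu.one_sub
  have hr := hp.one_sub
  set b := CFC.abs y with hb
  have hsb : star b = b := star_cfcAbs y
  set q := 1 - star u * u with hqd
  have hsq : star q = q := hq.isSelfAdjoint.star_eq
  have hqq : q * q = q := hq.isIdempotentElem
  set r := 1 - p with hrd
  have hsr : star r = r := hr.isSelfAdjoint.star_eq
  have hrr : r * r = r := hr.isIdempotentElem
  have hyy : star y * y = b * star u * p * u * b := by
    rw [hy]
    simp only [star_mul, hsp, hsb, mul_assoc]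
    rw [← mul_assoc p p, hpp]
  have hbb : b * b = star y * y := CFC.abs_mul_abs y
  -- The summands are the losses `b² - bu⋆ub` under `u` and `bu⋆ub - bu⋆pub` under `p`. They
  -- telescope to `b² - y⋆y = 0`, and both are nonnegative, so each vanishes.
  have hsum : star (q * b) * (q * b) + star (r * (u * b)) * (r * (u * b)) = 0 := by
    have e1 : star (q * b) * (q * b) = b * b - b * star u * u * b := by
      rw [star_mul, hsb, hsq, mul_assoc, ← mul_assoc q, hqq, hqd]; noncomm_ring
    have e2 : star (r * (u * b)) * (r * (u * b))
        = b * star u * u * b - b * star u * p * u * b := by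
      rw [star_mul, star_mul, hsb, hsr, mul_assoc, ← mul_assoc r, hrr, hrd]; noncomm_ring
    rw [e1, e2, hbb, hyy]; abel
  rw [add_eq_zero_iff_of_nonneg (star_mul_self_nonneg _) (star_mul_self_nonneg _),
    CStarRing.star_mul_self_eq_zero_iff, CStarRing.star_mul_self_eq_zero_iff] at hsum
  obtain ⟨h1, h2⟩ := hsum
  rw [hqd, sub_mul, one_mul, sub_eq_zero] at h1
  rw [hrd, sub_mul, one_mul, sub_eq_zero, ← mul_assoc, ← hy] at h2
  exact ⟨h2.symm, by rw [← h2, ← mul_assoc, ← h1]⟩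

end AbsoluteValue

/-! ### The equivalences, as C⋆-algebra identities. -/

section Compression

open PartialIsometry

variable {A : Type*} [CStarAlgebra A] {x y w u v s : A}

theorem mul_mul_eq_mul_compression_mul (hu : IsStarProjection (star u * u))
    (hs : IsStarProjection (star s * s)) (hw : w = star u * u * v * s * star s) :
    u * v * s = u * w * s := by
  calc u * v * s = u * star u * u * v * (s * star s * s) := by
        rw [mul_star_mul_self hu, mul_star_mul_self hs]
    _ = _ := by rw [hw]; simp only [mul_assoc]

theorem star_compression_mul (hu : IsStarProjection (star u * u))
    (hw : w = star u * u * v * s * star s) : star w * (star u * u) = star w := by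
  rw [hw]
  simp only [star_mul, star_star, mul_assoc]
  rw [← mul_assoc u (star u) u, mul_star_mul_self hu]

theorem star_mul_eq_self_of_mul_eq_self {p : A} (hp : star p = p) (h : p * y = y) :
    star y * p = star y := by
  simpa [hp] using congrArg star h

theorem mul_star_eq_self_of_mul_eq_self {p : A} (hp : star p = p) (h : y * p = y) :
    p * star y = star y := by
  simpa [hp] using congrArg star h

variable [PartialOrder A] [StarOrderedRing A]

theorem mul_star_self_mul_cfcAbs (hq : y * (s * star s) = y) :
    s * star s * CFC.abs y = CFC.abs y :=
  mul_cfcAbs_eq (by simp) (mul_star_eq_self_of_mul_eq_self (by simp) hq)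

theorem cfcAbs_mul_mul_star_self (hq : y * (s * star s) = y) :
    CFC.abs y * (s * star s) = CFC.abs y := by
  simpa [star_cfcAbs] using congrArg star (mul_star_self_mul_cfcAbs hq)

theorem compression_mul_cfcAbs (hq : y * (s * star s) = y)
    (hw : w = star u * u * v * s * star s) :
    w * CFC.abs y = star u * u * v * CFC.abs y := by
  rw [hw, mul_assoc _ s, mul_assoc _ (s * star s), mul_star_self_mul_cfcAbs hq]

/-- The right side is positive, and in its square the inner `ss⋆` is absorbed by `|y|`, leaving
`s⋆y⋆ys = x⋆x`. -/
theorem cfcAbs_mul_mul (hp : star u * u * y = y) (hq : y * (s * star s) = y)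
    (hx : x = u * y * s) : CFC.abs x = star s * CFC.abs y * s := by
  refine cfcAbs_eq_of_mul_self_eq (star_left_conjugate_nonneg (CFC.abs_nonneg y) s) ?_
  calc star s * CFC.abs y * s * (star s * CFC.abs y * s)
      = star s * (CFC.abs y * (s * star s) * CFC.abs y) * s := by noncomm_ring
    _ = star s * (star y * (star u * u * y)) * s := by
        rw [cfcAbs_mul_mul_star_self hq, CFC.abs_mul_abs, hp]
    _ = star x * x := by rw [hx]; simp only [star_mul, mul_assoc]

theorem eq_mul_cfcAbs_iff_eq_compression_mul_cfcAbs (hu : IsStarProjection (star u * u))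
    (hs : IsStarProjection (star s * s)) (hp : star u * u * y = y) (hq : y * (s * star s) = y)
    (hx : x = u * y * s) (hw : w = star u * u * v * s * star s) :
    x = u * v * s * CFC.abs x ↔ y = w * CFC.abs y := by
  have habs := cfcAbs_mul_mul hp hq hx
  have hqb := mul_star_self_mul_cfcAbs hq
  constructor <;> intro h
  · calc y = star u * u * y * (s * star s) := by rw [hp, hq]
      _ = star u * x * star s := by rw [hx]; simp only [mul_assoc]
      _ = star u * (u * v * s * CFC.abs x) * star s := by rw [← h]
      _ = star u * u * v * (s * star s * CFC.abs y * (s * star s)) := by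
          rw [habs]; simp only [mul_assoc]
      _ = w * CFC.abs y := by
          rw [hqb, cfcAbs_mul_mul_star_self hq, compression_mul_cfcAbs hq hw]
  · calc x = u * (w * CFC.abs y) * s := by rw [← h, hx]
      _ = u * (w * (s * star s * CFC.abs y)) * s := by rw [hqb]
      _ = u * v * s * CFC.abs x := by
          rw [mul_mul_eq_mul_compression_mul hu hs hw, habs]; simp only [mul_assoc]

theorem eq_compression_mul_cfcAbs_iff (hu : IsStarProjection (star u * u))
    (hv : IsStarProjection (star v * v)) (hp : star u * u * y = y) (hq : y * (s * star s) = y)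
    (hw : w = star u * u * v * s * star s) :
    y = w * CFC.abs y ↔ 0 ≤ star v * y ∧ v * star v * y = y := by
  rw [compression_mul_cfcAbs hq hw]
  constructor
  · intro h
    obtain ⟨h1, h2⟩ := eq_mul_cfcAbs_of_compression hv hu h
    rw [mul_assoc, h2, ← h1]
    exact ⟨CFC.abs_nonneg y, rfl⟩
  · rintro ⟨h1, h2⟩
    have e : CFC.abs y = star v * y := by
      refine cfcAbs_eq_of_mul_self_eq h1 ?_
      -- By self-adjointness the square is `(v⋆y)⋆(v⋆y) = y⋆(vv⋆y) = y⋆y`.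
      nth_rewrite 1 [← (IsSelfAdjoint.of_nonneg h1).star_eq]
      rw [star_mul, star_star, mul_assoc, ← mul_assoc v, h2]
    rw [e, mul_assoc (star u * u), ← mul_assoc v, h2, hp]

theorem star_compression_mul_eq_cfcAbs (hu : IsStarProjection (star u * u))
    (hv : IsStarProjection (star v * v)) (hp : star u * u * y = y) (hq : y * (s * star s) = y)
    (hw : w = star u * u * v * s * star s) (h : y = w * CFC.abs y) :
    star w * y = CFC.abs y := by
  rw [compression_mul_cfcAbs hq hw] at h
  calc star w * y = s * star s * (star v * (star u * u * y)) := by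
        rw [hw]; simp only [star_mul, star_star, mul_assoc]
    _ = CFC.abs y := by
        rw [hp, (eq_mul_cfcAbs_of_compression hv hu h).2, mul_star_self_mul_cfcAbs hq]

theorem star_mul_mul_eq_cfcAbs (hp : star u * u * y = y) (hq : y * (s * star s) = y)
    (hx : x = u * y * s) (h : star w * y = CFC.abs y) :
    star (u * w * s) * x = CFC.abs x := by
  calc star (u * w * s) * x = star s * (star w * (star u * u * y)) * s := by
        rw [hx]; simp only [star_mul, mul_assoc]
    _ = CFC.abs x := by rw [hp, h, cfcAbs_mul_mul hp hq hx]

end Compression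

namespace HilbertModule

variable {𝔄 H : Type*} [NonUnitalCStarAlgebra 𝔄] [PartialOrder 𝔄]
  [NormedAddCommGroup H] [NormedSpace ℂ H] [SMul 𝔄 H] [CStarModule 𝔄 H]

/-! ### Closures of ranges and projections onto them. -/

section RangeClosure

theorem apply_mem_rangeClosure (T : adjointable 𝔄 H) (x : H) : T.1 x ∈ rangeClosure T :=
  Submodule.le_topologicalClosure _ ⟨x, rfl⟩

theorem mul_apply (T S : adjointable 𝔄 H) (x : H) : (T * S).1 x = T.1 (S.1 x) := rfl

theorem ext_apply {T S : adjointable 𝔄 H} (h : ∀ x, T.1 x = S.1 x) : T = S :=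
  Subtype.ext (ContinuousLinearMap.ext h)

theorem apply_mem_of_mem_rangeClosure {B C D : adjointable 𝔄 H}
    (h : ∀ y, B.1 (C.1 y) ∈ rangeClosure D) {x : H} (hx : x ∈ rangeClosure C) :
    B.1 x ∈ rangeClosure D := by
  have hcl : IsClosed (B.1 ⁻¹' (rangeClosure D : Set H)) :=
    (Submodule.isClosed_topologicalClosure _).preimage B.1.continuous
  refine closure_minimal ?_ hcl hx
  rintro _ ⟨y, rfl⟩
  exact h y

theorem apply_eq_self_of_mem_rangeClosure {P C : adjointable 𝔄 H} (h : P * C = C) {x : H}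
    (hx : x ∈ rangeClosure C) : P.1 x = x := by
  have hcl : IsClosed {x | P.1 x = x} := isClosed_eq P.1.continuous continuous_id
  refine closure_minimal ?_ hcl hx
  rintro _ ⟨y, rfl⟩
  exact congrArg (fun R : adjointable 𝔄 H => R.1 y) h

theorem IsProjectionOnto.apply_mem {P : adjointable 𝔄 H} {M : Submodule ℂ H}
    (h : IsProjectionOnto P M) (x : H) : P.1 x ∈ M := by
  obtain ⟨y, hy, z, hz, rfl⟩ := Submodule.mem_sup.1
    (codisjoint_iff_le_sup.1 h.isCompl.codisjoint (Submodule.mem_top (x := x)))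
  rw [map_add, h.apply_of_mem y hy, h.apply_of_mem_orthogonal z hz, add_zero]
  exact hy

theorem rangeClosure_le {C D : adjointable 𝔄 H} (h : ∀ y, C.1 y ∈ rangeClosure D) :
    rangeClosure C ≤ rangeClosure D :=
  fun _ hx => apply_mem_of_mem_rangeClosure (B := 1) (C := C) h hx

theorem mul_eq_of_rangeClosure_le {P C D : adjointable 𝔄 H} (h : P * C = C)
    (hD : rangeClosure D ≤ rangeClosure C) : P * D = D :=
  ext_apply fun x => apply_eq_self_of_mem_rangeClosure h (hD (apply_mem_rangeClosure D x))

theorem IsProjectionOnto.mul_eq {P C : adjointable 𝔄 H}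
    (h : IsProjectionOnto P (rangeClosure C)) : P * C = C :=
  ext_apply fun x => h.apply_of_mem _ (apply_mem_rangeClosure C x)

variable [StarOrderedRing 𝔄]

theorem abs_apply_mem_rangeClosure_star [CompleteSpace H] (T : adjointable 𝔄 H) (x : H) :
    (CFC.abs T).1 x ∈ rangeClosure (star T) := by
  refine Metric.mem_closure_iff.2 fun ε hε => ?_
  obtain ⟨c, hc⟩ := exists_norm_cfcAbs_sub_lt T (ε := ε / (‖x‖ + 1)) (by positivity)
  refine ⟨(star T).1 (T.1 (c.1 x)), ⟨_, rfl⟩, ?_⟩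
  rw [dist_eq_norm]
  calc ‖(CFC.abs T).1 x - (star T).1 (T.1 (c.1 x))‖
      = ‖(CFC.abs T - star T * T * c).1 x‖ := rfl
    _ ≤ ‖(CFC.abs T - star T * T * c).1‖ * ‖x‖ := ContinuousLinearMap.le_opNorm _ _
    _ ≤ ε / (‖x‖ + 1) * ‖x‖ := by gcongr; exact hc
    _ < ε := by
      rw [div_mul_eq_mul_div, div_lt_iff₀ (by positivity)]
      nlinarith [norm_nonneg x]

/-- A self-adjoint `P` that fixes the range of `C`, and whose range lies in its closure, is the
projection onto that closure. -/
theorem isProjectionOnto_rangeClosure {P C : adjointable 𝔄 H} (hP : star P = P) (h : P * C = C)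
    (hle : ∀ x, P.1 x ∈ rangeClosure C) : IsProjectionOnto P (rangeClosure C) := by
  have hmem : ∀ x ∈ rangeClosure C, P.1 x = x := fun x hx => apply_eq_self_of_mem_rangeClosure h hx
  refine ⟨⟨?_, ?_⟩, hmem, fun x hx => ?_⟩
  · rw [Submodule.disjoint_def]
    exact fun x hx hx' => (CStarModule.inner_self (A := 𝔄)).mp (hx' x hx)
  · refine codisjoint_iff_le_sup.2 fun x _ => Submodule.mem_sup.2
      ⟨P.1 x, hle x, x - P.1 x, fun y hy => ?_, add_sub_cancel _ _⟩
    rw [CStarModule.inner_sub_left, inner_star_right, hP, hmem y hy, sub_self]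
  · refine (CStarModule.inner_self (A := 𝔄)).mp ?_
    rw [inner_star_right, hP, hmem _ (hle x)]
    exact hx _ (hle x)

/-- `hD` gives `E⋆D⋆z = (E⋆D⋆B⋆)(Bz)`, so multiplying by `B⋆` on the right loses none of the range
of `E⋆D⋆`. -/
theorem rangeClosure_star_mul_mul_le {B C D E : adjointable 𝔄 H}
    (h : rangeClosure (star C) ≤ rangeClosure (star D)) (hD : star D * (star B * B) = star D) :
    rangeClosure (star (B * C * E)) ≤ rangeClosure (star (B * D * E)) := by
  have e : ∀ Z : adjointable 𝔄 H, star (B * Z * E) = star E * star Z * star B := fun Z => by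
    rw [star_mul, star_mul, mul_assoc]
  rw [e, e]
  refine rangeClosure_le fun y => ?_
  refine apply_mem_of_mem_rangeClosure (B := star E) (C := star D) (fun z => ?_)
    (h (apply_mem_rangeClosure (star C) ((star B).1 y)))
  have hz : (star E).1 ((star D).1 z) = (star E * star D * star B).1 (B.1 z) :=
    congrArg (fun R : adjointable 𝔄 H => (star E).1 (R.1 z)) hD.symm
  rw [hz]
  exact apply_mem_rangeClosure _ _

end RangeClosure

/-! ### Consequences of, and a criterion for, polar decomposition. -/

namespace IsPolarDecomposition

open PartialIsometry

variable [StarOrderedRing 𝔄] [CompleteSpace H] {T U : adjointable 𝔄 H}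

theorem star_mul_self_mul_abs (h : IsPolarDecomposition T U) :
    star U * U * CFC.abs T = CFC.abs T :=
  mul_cfcAbs_eq h.partialIsometry.isSelfAdjoint.star_eq h.isProjectionOnto.mul_eq

theorem abs_mul_star_mul_self (h : IsPolarDecomposition T U) :
    CFC.abs T * (star U * U) = CFC.abs T := by
  simpa [star_cfcAbs] using congrArg star h.star_mul_self_mul_abs

theorem abs_star_eq (h : IsPolarDecomposition T U) :
    CFC.abs (star T) = U * CFC.abs T * star U := by
  refine cfcAbs_eq_of_mul_self_eq (star_right_conjugate_nonneg (CFC.abs_nonneg T) U) ?_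
  have e : star (star T) * star T = U * CFC.abs T * (CFC.abs T * star U) := by
    conv_lhs => rw [star_star, h.eq_mul_abs, star_mul, star_cfcAbs]
  rw [e]
  calc U * CFC.abs T * star U * (U * CFC.abs T * star U)
      = U * CFC.abs T * (star U * U * CFC.abs T) * star U := by noncomm_ring
    _ = _ := by rw [h.star_mul_self_mul_abs]; noncomm_ring

theorem eq_abs_star_mul (h : IsPolarDecomposition T U) : T = CFC.abs (star T) * U := by
  rw [h.abs_star_eq, mul_assoc, mul_assoc, h.abs_mul_star_mul_self, ← h.eq_mul_abs]

theorem abs_star_mul_mul_star_self (h : IsPolarDecomposition T U) :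
    CFC.abs (star T) * (U * star U) = CFC.abs (star T) := by
  rw [← mul_assoc, ← h.eq_abs_star_mul, h.abs_star_eq, ← h.eq_mul_abs]

theorem star_eq_abs_mul_star (h : IsPolarDecomposition T U) : star T = CFC.abs T * star U := by
  have := congrArg star h.eq_mul_abs
  rwa [star_mul, star_cfcAbs] at this

theorem rangeClosure_star_right (h : IsPolarDecomposition T U) :
    rangeClosure (star U) = rangeClosure (star T) := by
  refine le_antisymm (rangeClosure_le fun y => ?_) (rangeClosure_le fun y => ?_)
  · rw [← star_mul_self_mul_star h.partialIsometry]
    exact h.isProjectionOnto.apply_mem _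
  · rw [← h.isProjectionOnto.mul_eq]
    exact apply_mem_rangeClosure (star U) _

theorem rangeClosure_right (h : IsPolarDecomposition T U) :
    rangeClosure U = rangeClosure T := by
  refine le_antisymm (rangeClosure_le fun y => ?_) (rangeClosure_le fun y => ?_)
  · have e : U * star T = T * star U := by
      rw [h.star_eq_abs_mul_star, ← mul_assoc, ← h.eq_mul_abs]
    rw [← mul_star_mul_self h.partialIsometry, mul_assoc]
    refine apply_mem_of_mem_rangeClosure (B := U) (C := star T) (fun z => ?_)
      (h.isProjectionOnto.apply_mem y)
    rw [← mul_apply, e]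
    exact apply_mem_rangeClosure T _
  · rw [h.eq_mul_abs]
    exact apply_mem_rangeClosure U _

/-- If `T = U|T|` and `U⋆T = |T|`, then this is the polar decomposition as soon as the range of `U`
or of `U⋆` has the same closure as that of `T` or of `T⋆`. -/
theorem of_rangeClosure_eq (h : T = U * CFC.abs T) (h' : star U * T = CFC.abs T)
    (hr : rangeClosure U = rangeClosure T ∨ rangeClosure (star U) = rangeClosure (star T)) :
    IsPolarDecomposition T U := by
  have hs : star T = CFC.abs T * star U := by
    have := congrArg star h
    rwa [star_mul, star_cfcAbs] at this
  have hTs : star U * U * star T = star T := by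
    rw [hs, ← mul_assoc, mul_assoc (star U), ← h, h']
  have hU : IsStarProjection (star U * U) := by
    refine isStarProjection_of_mul_star_mul_self ?_
    -- Either `UU⋆` fixes the range of `T`, hence that of `U`, or `U⋆U` fixes the range of `T⋆`,
    -- hence that of `U⋆`. Both give `UU⋆U = U`.
    rcases hr with hr | hr
    · refine mul_eq_of_rangeClosure_le (C := T) ?_ hr.le
      rw [mul_assoc, h', ← h]
    · have := congrArg star (mul_eq_of_rangeClosure_le hTs hr.le)
      simpa [mul_assoc] using this
  refine ⟨hU, h, isProjectionOnto_rangeClosure hU.isSelfAdjoint.star_eq hTs fun x => ?_⟩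
  rcases hr with hr | hr
  · refine apply_mem_of_mem_rangeClosure (B := star U) (C := T) (fun y => ?_)
      (hr.le (apply_mem_rangeClosure U x))
    rw [← mul_apply, h']
    exact abs_apply_mem_rangeClosure_star T y
  · exact hr.le (apply_mem_rangeClosure (star U) _)

end IsPolarDecomposition

end HilbertModule

open HilbertModule in
theorem theorem4p2 {𝔄 H : Type*}
    [NonUnitalCStarAlgebra 𝔄] [PartialOrder 𝔄] [StarOrderedRing 𝔄]
    [NormedAddCommGroup H] [NormedSpace ℂ H] [SMul 𝔄 H] [CStarModule 𝔄 H] [CompleteSpace H]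
    (T A S U_T U_A U_S X Y W : adjointable 𝔄 H)
    (hT : IsPolarDecomposition T U_T)
    (hA : IsPolarDecomposition A U_A)
    (hS : IsPolarDecomposition S U_S)
    (hX : X = T * A * S)
    (hY : Y = CFC.abs T * A * CFC.abs (star S))
    (hW : W = star U_T * U_T * U_A * U_S * star U_S) :
    List.TFAE [
      X = U_T * U_A * U_S * CFC.abs X,
      Y = W * CFC.abs Y,
      0 ≤ star U_A * Y ∧ U_A * star U_A * Y = Y] ∧
    ((X = U_T * U_A * U_S * CFC.abs X ∨ Y = W * CFC.abs Y ∨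
        (0 ≤ star U_A * Y ∧ U_A * star U_A * Y = Y)) →
      (rangeClosure W = rangeClosure Y ∨ rangeClosure (star W) = rangeClosure (star Y)) →
      IsPolarDecomposition X (U_T * U_A * U_S) ∧ IsPolarDecomposition Y W) ∧
    (IsPolarDecomposition Y W →
      rangeClosure W = rangeClosure Y ∧ rangeClosure (star W) = rangeClosure (star Y)) := by
  have hu := hT.partialIsometry
  have hv := hA.partialIsometry
  have hs := hS.partialIsometry
  have hp : star U_T * U_T * Y = Y := by
    rw [hY, mul_assoc (CFC.abs T), ← mul_assoc, hT.star_mul_self_mul_abs]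
  have hq : Y * (U_S * star U_S) = Y := by
    rw [hY, mul_assoc, hS.abs_star_mul_mul_star_self]
  have hXY : X = U_T * Y * U_S :=
    calc X = U_T * CFC.abs T * A * (CFC.abs (star S) * U_S) := by
          rw [← hT.eq_mul_abs, ← hS.eq_abs_star_mul, hX]
      _ = U_T * Y * U_S := by rw [hY]; simp only [mul_assoc]
  have h12 := eq_mul_cfcAbs_iff_eq_compression_mul_cfcAbs hu hs hp hq hXY hW
  have h23 := eq_compression_mul_cfcAbs_iff hu hv hp hq hW
  refine ⟨?_, fun h hr => ?_, fun h => ⟨h.rangeClosure_right, h.rangeClosure_star_right⟩⟩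
  · tfae_have 1 ↔ 2 := h12
    tfae_have 2 ↔ 3 := h23
    tfae_finish
  rw [h12, ← h23, or_self, or_self] at h
  have hWY := star_compression_mul_eq_cfcAbs hu hv hp hq hW h
  have hpol : IsPolarDecomposition Y W := .of_rangeClosure_eq h hWY hr
  have hV := mul_mul_eq_mul_compression_mul hu hs hW
  -- The adjoint alternative is available whichever one was assumed, since `hpol` yields both range
  -- equalities for `Y`.
  refine ⟨.of_rangeClosure_eq (h12.2 h) ?_ (.inr ?_), hpol⟩
  · rw [hV]
    exact star_mul_mul_eq_cfcAbs hp hq hXY hWY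
  · rw [hV, hXY]
    exact le_antisymm
      (rangeClosure_star_mul_mul_le hpol.rangeClosure_star_right.le
        (star_mul_eq_self_of_mul_eq_self (IsSelfAdjoint.star_mul_self U_T).star_eq hp))
      (rangeClosure_star_mul_mul_le hpol.rangeClosure_star_right.ge (star_compression_mul hu hW))
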